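/- Let $K$ be an integral domain, let $s\ge 1$ and $n_s\ge n_{s-1}\ge\dots\ge n_1\ge 1$ be integers, and let $\underline X_j=(X_{j,1},\dots,X_{j,n_j+1})$, $1\le j\le s$, be $s$ packets of variables. Let $r\ge 0$ and let $d_{i,j}\ge 1$ ($1\le i\le r$, $1\le j\le s$) be integers. For $1\le i\le r$ let $$f_i=\sum U_{i,\alpha_1,\dots,\alpha_s}\,\underline X_1^{\alpha_1}\cdots\underline X_s^{\alpha_s}$$ be the generic multihomogeneous polynomial of multidegree $(d_{i,1},\dots,d_{i,s})$, the sum being over all $\alpha_j\in\mathbb N^{n_j+1}$ with $|\alpha_j|=d_{i,j}$ ($1\le j\le s$) and the $U_{i,\alpha_1,\dots,\alpha_s}$ being independent indeterminates over $K$. Let $A=K[U_{i,\alpha_1,\dots,\alpha_s}]$ be the ring generated by all these coefficients, $C=A[\underline X_1,\dots,\underline X_s]$ and $B=C/(f_1,\dots,f_r)$. Let $\mathfrak M\subset C$ be the ideal generated by the monomials $\sigma_{i_1\dots i_s}=X_{1,i_1}\cdots X_{s,i_s}$ ($1\le i_j\le n_j+1$), and for a $C$-module $M$ let $H^i_{\mathfrak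 M}(M)$ be the $i$-th cohomology module of the augmented Čech complex $$0\to M\to\prod_{a}M_{\sigma_a}\to\prod_{a<b}M_{\sigma_a\sigma_b}\to\cdots$$ of $M$ with respect to these monomials, $M$ being placed in degree $0$. Let $K^\bullet$ be the Koszul complex of $f_1,\dots,f_r$ over $C$, with $K^{-p}=\bigwedge^p(C^r)$. Suppose that $r\le n_1+1$. Then: 1. The Koszul complex is acyclic except in degree $0$: $H^{i}(K^\bullet)=0$ for all $i\ne 0$. 2. If $r<n_1+1$, then $H^i_{\mathfrak M}(B)=0$ for all integers $i$ with $0\le i<n_1+1-r$. -/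

import Mathlib

universe u v

/-! ### Signs -/

/-- `insertionSign R I k = (-1) ^ #{i ∈ I | i < k}`. If `k` has position `l` in the increasing
enumeration of `I ∪ {k}` (positions starting at `1`), this is `(-1) ^ (l - 1)`. -/
def insertionSign (R : Type*) [CommRing R] {ι : Type*} [LinearOrder ι] (I : Finset ι) (k : ι) : R :=
  (-1) ^ (I.filter (fun i => i < k)).card

theorem insertionSign_insert_mul {R : Type*} [CommRing R] {ι : Type*} [LinearOrder ι]
    (I : Finset ι) {k l : ι} (hk : k ∉ I) (hl : l ∉ I) (hkl : k ≠ l) :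
    insertionSign R I k * insertionSign R (insert k I) l =
      -(insertionSign R I l * insertionSign R (insert l I) k) := by
  unfold insertionSign
  rw [Finset.filter_insert, Finset.filter_insert]
  rcases lt_or_gt_of_ne hkl with h | h
  · rw [if_pos h, if_neg (not_lt.2 h.le), Finset.card_insert_of_notMem (by simp [hk])]
    ring
  · rw [if_neg (not_lt.2 h.le), if_pos h, Finset.card_insert_of_notMem (by simp [hl])]
    ring

theorem insertionSign_erase_mul {R : Type*} [CommRing R] {ι : Type*} [LinearOrder ι]
    (J : Finset ι) {k l : ι} (hk : k ∈ J) (hl : l ∈ J) (hkl : k ≠ l) :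
    insertionSign R J k * insertionSign R (J.erase k) l =
      -(insertionSign R J l * insertionSign R (J.erase l) k) := by
  have key : ∀ a b : ι, a ∈ J → a < b →
      insertionSign R J b = -insertionSign R (J.erase a) b ∧
      insertionSign R (J.erase b) a = insertionSign R J a := by
    intro a b ha hab
    unfold insertionSign
    constructor
    · have h : J.filter (fun i => i < b) = insert a ((J.erase a).filter (fun i => i < b)) := by
        have h := Finset.filter_insert (fun i => i < b) a (J.erase a)
        rwa [if_pos hab, Finset.insert_erase ha] at h
      rw [h, Finset.card_insert_of_notMem (by simp), pow_succ]
      ring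
    · congr 2
      ext x
      simp only [Finset.mem_filter, Finset.mem_erase]
      exact ⟨fun h => ⟨h.1.2, h.2⟩, fun h => ⟨⟨(h.2.trans hab).ne, h.1⟩, h.2⟩⟩
  rcases lt_or_gt_of_ne hkl with h | h
  · rw [(key k l hk h).1, (key k l hk h).2]; ring
  · rw [(key l k hl h).1, (key l k hl h).2]; ring

/-! ### The Koszul complex -/

section Koszul

variable {R : Type u} [CommRing R] {r : ℕ}

/-- The module `K_p = ⋀ᵖ(Rʳ)`, which is free on the elements `e_I = e_{i₁} ∧ … ∧ e_{iₚ}` where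
`I = {i₁ < … < iₚ}`. An element is given by its coordinates `(m_I)` in this basis. -/
abbrev KoszulModule (R : Type u) [CommRing R] (r p : ℕ) : Type u :=
  {I : Finset (Fin r) // I.card = p} → R

/-- The Koszul differential `K_{p+1} → K_p`,
`e_{i₁} ∧ … ∧ e_{i_{p+1}} ↦ ∑ₖ (-1)^(k+1) a_{iₖ} e_{i₁} ∧ … ê_{iₖ} … ∧ e_{i_{p+1}}`, in coordinates:
`(d m)_J = ∑_{k ∉ J} (-1)^#{j ∈ J | j < k} a_k m_{J ∪ {k}}`. -/
def koszulD (a : Fin r → R) (p : ℕ) : KoszulModule R r (p + 1) →ₗ[R] KoszulModule R r p :=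
  LinearMap.pi fun J => ∑ k : {k : Fin r // k ∉ J.1},
    (insertionSign R J.1 k.1 * a k.1) •
      LinearMap.proj (R := R) (φ := fun _ : {I : Finset (Fin r) // I.card = p + 1} => R)
        ⟨insert k.1 J.1, by rw [Finset.card_insert_of_notMem k.2, J.2]⟩

theorem koszulD_apply (a : Fin r → R) (p : ℕ) (m : KoszulModule R r (p + 1))
    (J : {I : Finset (Fin r) // I.card = p}) :
    koszulD a p m J = ∑ k : {k : Fin r // k ∉ J.1}, insertionSign R J.1 k.1 * a k.1 *
      m ⟨insert k.1 J.1, by rw [Finset.card_insert_of_notMem k.2, J.2]⟩ := by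
  simp [koszulD, LinearMap.pi_apply, LinearMap.sum_apply]

theorem koszulD_comp (a : Fin r → R) (p : ℕ) : koszulD a p ∘ₗ koszulD a (p + 1) = 0 := by
  refine LinearMap.ext fun m => ?_
  funext J
  simp only [LinearMap.comp_apply, koszulD_apply, Finset.mul_sum, LinearMap.zero_apply,
    Pi.zero_apply]
  rw [Finset.sum_sigma']
  refine Finset.sum_involution
    (fun x _ => ⟨⟨x.2.1, fun h => x.2.2 (Finset.mem_insert_of_mem h)⟩, ⟨x.1.1, fun h => by
      rcases Finset.mem_insert.1 h with h | h
      · exact x.2.2 (h ▸ Finset.mem_insert_self _ _)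
      · exact x.1.2 h⟩⟩) ?_ ?_ ?_ ?_
  · rintro ⟨⟨k, hk⟩, ⟨l, hl⟩⟩ -
    have hkl : k ≠ l := fun h => hl (h ▸ Finset.mem_insert_self _ _)
    have hlJ : l ∉ J.1 := fun h => hl (Finset.mem_insert_of_mem h)
    have h := insertionSign_insert_mul (R := R) J.1 hk hlJ hkl
    have hc : ∀ (I I' : Finset (Fin r)) (hI : I.card = p + 1 + 1) (hI' : I'.card = p + 1 + 1),
        I = I' → m ⟨I, hI⟩ = m ⟨I', hI'⟩ := by
      intro I I' hI hI' e; subst e; rfl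
    have hm := hc (insert l (insert k J.1)) (insert k (insert l J.1))
      (by rw [Finset.card_insert_of_notMem hl, Finset.card_insert_of_notMem hk, J.2])
      (by rw [Finset.insert_comm, Finset.card_insert_of_notMem hl,
        Finset.card_insert_of_notMem hk, J.2]) (Finset.insert_comm _ _ _)
    dsimp only
    rw [hm]
    linear_combination (a k * a l * m ⟨insert k (insert l J.1), _⟩) * h
  · rintro ⟨⟨k, hk⟩, ⟨l, hl⟩⟩ - - h
    have h1 := congrArg (fun x => x.1.1) h
    exact hl (Finset.mem_insert.2 (Or.inl h1))
  · intros; exact Finset.mem_sigma.2 ⟨Finset.mem_univ _, Finset.mem_univ _⟩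
  · intros; rfl

/-- The Koszul complex `K_•(a; R)` of a finite sequence `a`. -/
noncomputable def koszulComplex (a : Fin r → R) : ChainComplex (ModuleCat.{u} R) ℕ :=
  ChainComplex.of (fun p => ModuleCat.of R (KoszulModule R r p))
    (fun p => ModuleCat.ofHom (koszulD a p))
    (fun p => by rw [← ModuleCat.ofHom_comp, koszulD_comp]; rfl)

end Koszul

/-! ### The augmented Čech complex -/

section Cech

variable {R : Type u} [CommRing R] {ι : Type} [LinearOrder ι]

/-- `M_{a_I}`, the localization of `M` at the powers of `a_I = ∏ i ∈ I, a i`;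
for `I = ∅` this is `M` (localized at `1`). -/
abbrev CechLoc (a : ι → R) (M : Type u) [AddCommGroup M] [Module R M] (I : Finset ι) : Type u :=
  LocalizedModule (Submonoid.powers (∏ i ∈ I, a i)) M

variable (a : ι → R) (M : Type u) [AddCommGroup M] [Module R M]

theorem isUnit_cechLoc {I J : Finset ι} (h : I ⊆ J)
    (x : Submonoid.powers (∏ i ∈ I, a i)) :
    IsUnit (algebraMap R (Module.End R (CechLoc a M J)) x) := by
  obtain ⟨_, n, rfl⟩ := x
  have h1 : IsUnit (algebraMap R (Module.End R (CechLoc a M J)) (∏ i ∈ J, a i)) :=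
    IsLocalizedModule.map_units (S := Submonoid.powers (∏ i ∈ J, a i))
      (LocalizedModule.mkLinearMap (Submonoid.powers (∏ i ∈ J, a i)) M)
      ⟨∏ i ∈ J, a i, Submonoid.mem_powers _⟩
  obtain ⟨c, hc⟩ := Finset.prod_dvd_prod_of_subset _ _ a h
  have h3 := congrArg (algebraMap R (Module.End R (CechLoc a M J))) hc
  rw [h3, map_mul] at h1
  have hcomm : Commute (algebraMap R (Module.End R (CechLoc a M J)) (∏ i ∈ I, a i))
      (algebraMap R (Module.End R (CechLoc a M J)) c) := Algebra.commutes _ _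
  have h2 := (hcomm.isUnit_mul_iff.1 h1).1
  simp only [map_pow]
  exact h2.pow n

/-- The canonical map `M_{a_I} → M_{a_J}`, `m / a_I ^ n ↦ (a_{J \ I}) ^ n m / a_J ^ n`, for `I ⊆ J`:
the unique `R`-linear map compatible with the maps from `M`. -/
noncomputable def cechRes {I J : Finset ι} (h : I ⊆ J) : CechLoc a M I →ₗ[R] CechLoc a M J :=
  LocalizedModule.lift _ (LocalizedModule.mkLinearMap _ M) (isUnit_cechLoc a M h)

theorem cechRes_comp_mk {I J : Finset ι} (h : I ⊆ J) :
    cechRes a M h ∘ₗ LocalizedModule.mkLinearMap _ M = LocalizedModule.mkLinearMap _ M :=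
  LocalizedModule.lift_comp _ _ _

theorem cechRes_comp {I J L : Finset ι} (h : I ⊆ J) (h' : J ⊆ L) :
    cechRes a M h' ∘ₗ cechRes a M h = cechRes a M (h.trans h') := by
  refine IsLocalizedModule.ext (Submonoid.powers (∏ i ∈ I, a i))
    (LocalizedModule.mkLinearMap _ M) (isUnit_cechLoc a M (h.trans h')) ?_
  rw [LinearMap.comp_assoc, cechRes_comp_mk, cechRes_comp_mk, cechRes_comp_mk]

/-- The degree `p` term `∏_{#I = p} M_{a_I}` of the augmented Čech complex. -/
abbrev CechModule (p : ℕ) : Type u :=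
  (I : {I : Finset ι // I.card = p}) → CechLoc a M I.1

/-- The differential of the augmented Čech complex:
`(d m)_J = ∑_{j ∈ J} (-1)^(l_j - 1) m_{J \ {j}} / 1`, with `l_j` the position of `j` in `J`.
In degree `0` it is the augmentation `m ↦ (m / 1)_i`. -/
noncomputable def cechD (p : ℕ) : CechModule a M p →ₗ[R] CechModule a M (p + 1) :=
  LinearMap.pi fun J => ∑ j : {j : ι // j ∈ J.1},
    insertionSign R J.1 j.1 •
      (cechRes a M (Finset.erase_subset j.1 J.1) ∘ₗ
        LinearMap.proj (R := R)
          (φ := fun I : {I : Finset ι // I.card = p} => CechLoc a M I.1)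
          ⟨J.1.erase j.1, by rw [Finset.card_erase_of_mem j.2, J.2]; rfl⟩)

theorem cechD_apply (p : ℕ) (m : CechModule a M p) (J : {I : Finset ι // I.card = p + 1}) :
    cechD a M p m J = ∑ j : {j : ι // j ∈ J.1}, insertionSign R J.1 j.1 •
      cechRes a M (Finset.erase_subset j.1 J.1)
        (m ⟨J.1.erase j.1, by rw [Finset.card_erase_of_mem j.2, J.2]; rfl⟩) := by
  simp [cechD, LinearMap.pi_apply, LinearMap.sum_apply]

theorem cechRes_congr {p : ℕ} (m : CechModule a M p) {J I I' : Finset ι} (e : I = I')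
    (hI : I.card = p) (hI' : I'.card = p) (h : I ⊆ J) (h' : I' ⊆ J) :
    cechRes a M h (m ⟨I, hI⟩) = cechRes a M h' (m ⟨I', hI'⟩) := by
  subst e; rfl

theorem cechD_comp (p : ℕ) : cechD a M (p + 1) ∘ₗ cechD a M p = 0 := by
  refine LinearMap.ext fun m => ?_
  funext J
  simp only [LinearMap.comp_apply, cechD_apply, map_sum, map_smul, Finset.smul_sum, smul_smul,
    LinearMap.zero_apply, Pi.zero_apply]
  simp only [← LinearMap.comp_apply, cechRes_comp]
  rw [Finset.sum_sigma']
  refine Finset.sum_involution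
    (fun x _ => ⟨⟨x.2.1, Finset.mem_of_mem_erase x.2.2⟩, ⟨x.1.1, Finset.mem_erase.2
      ⟨fun h => (Finset.mem_erase.1 x.2.2).1 h.symm, x.1.2⟩⟩⟩) ?_ ?_ ?_ ?_
  · rintro ⟨⟨k, hk⟩, ⟨l, hl⟩⟩ -
    obtain ⟨hlk, hlJ⟩ := Finset.mem_erase.1 hl
    have h := insertionSign_erase_mul (R := R) J.1 hk hlJ (Ne.symm hlk)
    simp only [h, neg_smul]
    rw [neg_add_eq_zero]
    congr 1
    exact cechRes_congr a M m Finset.erase_right_comm _ _ _ _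
  · rintro ⟨⟨k, hk⟩, ⟨l, hl⟩⟩ - - h
    have h1 := congrArg (fun x => x.1.1) h
    exact (Finset.mem_erase.1 hl).1 h1
  · intros; exact Finset.mem_sigma.2 ⟨Finset.mem_univ _, Finset.mem_univ _⟩
  · intros; rfl

/-- The augmented Čech complex `0 → M → ∏ᵢ M_{aᵢ} → ∏_{i<j} M_{aᵢaⱼ} → …` of a module `M` with
respect to a family `a`. -/
noncomputable def augmentedCechComplex : CochainComplex (ModuleCat.{u} R) ℕ :=
  CochainComplex.of (fun p => ModuleCat.of R (CechModule a M p))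
    (fun p => ModuleCat.ofHom (cechD a M p))
    (fun p => by rw [← ModuleCat.ofHom_comp, cechD_comp]; rfl)

end Cech

/-! ### Generic multihomogeneous polynomials -/

section Generic

variable {s r : ℕ} (n : Fin s → ℕ) (d : Fin r → Fin s → ℕ)

/-- The tuples `(α₁, …, α_s)` with `α_j ∈ ℕ^{n_j+1}` and `|α_j| = e_j` for all `j`. -/
def multiExponents (e : Fin s → ℕ) : Finset ((j : Fin s) → Fin (n j + 1) → ℕ) :=
  Fintype.piFinset fun j => Finset.piAntidiag Finset.univ (e j)

theorem mem_multiExponents (e : Fin s → ℕ) (α : (j : Fin s) → Fin (n j + 1) → ℕ) :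
    α ∈ multiExponents n e ↔ ∀ j, ∑ l, α j l = e j := by
  simp [multiExponents]

/-- The indices of the indeterminates `U_{i, α₁, …, α_s}`. -/
abbrev CoeffIndex : Type := (i : Fin r) × {α // α ∈ multiExponents n (d i)}

/-- The ring of universal coefficients `A = K[U_{i, α₁, …, α_s}]`. -/
abbrev CoeffRing (K : Type u) [CommRing K] : Type u := MvPolynomial (CoeffIndex n d) K

/-- The ring `C = A[X₁, …, X_s]`, where `X_j = (X_{j,1}, …, X_{j,n_j+1})`. -/
abbrev FormRing (K : Type u) [CommRing K] : Type u :=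
  MvPolynomial ((j : Fin s) × Fin (n j + 1)) (CoeffRing n d K)

variable (K : Type u) [CommRing K]

/-- The generic multihomogeneous polynomial `f_i = ∑ U_{i, α₁, …, α_s} X₁^{α₁} ⋯ X_s^{α_s}` of
multidegree `(d_{i,1}, …, d_{i,s})`. -/
noncomputable def genericForm (i : Fin r) : FormRing n d K :=
  ∑ α : {α // α ∈ multiExponents n (d i)},
    MvPolynomial.C (MvPolynomial.X ⟨i, α⟩) *
      ∏ j : Fin s, ∏ l : Fin (n j + 1), MvPolynomial.X ⟨j, l⟩ ^ α.1 j l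

/-- The quotient `B = C / (f₁, …, f_r)`. -/
abbrev GenericQuotient : Type u :=
  FormRing n d K ⧸ Ideal.span (Set.range (genericForm n d K))

/-- The monomials `σ_{i₁…i_s} = X_{1,i₁} ⋯ X_{s,i_s}` generating the ideal `𝔐`, with the
lexicographic order on the indices `(i₁, …, i_s)`. -/
noncomputable def sigmaMonomial (t : Πₗ j : Fin s, Fin (n j + 1)) : FormRing n d K :=
  ∏ j : Fin s, MvPolynomial.X ⟨j, ofLex t j⟩

/-- `H_𝔐^i(B)`, the local cohomology of `B` with respect to the ideal `𝔐` of `C` generated by the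
monomials `σ_{i₁…i_s}`, computed by the augmented Čech complex on these monomials. -/
noncomputable def localCohomologyB (i : ℕ) : ModuleCat.{u} (FormRing n d K) :=
  (augmentedCechComplex (sigmaMonomial n d K) (GenericQuotient n d K)).homology i

end Generic

/-! Put N = n₁ + 1, the size of the smallest packet, and I_k = (f₁, …, f_k). Everything follows once
f₁, …, f_r is known to be a weakly regular sequence on C: the Koszul complex is then acyclic in
positive degrees, and each regular element costs at most one degree of vanishing of Čech cohomology.

The starting point is that 𝔐 has grade at least N on C. The N diagonal monomials X_{1,l} ⋯ X_{s,l}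
are among the generators of 𝔐 and have pairwise disjoint supports, so they form a regular sequence,
and the augmented Čech complex of C is exact in degrees < N (`cechExact_formRing_quotient_bot`).
This uses `CechExact.of_quotient`, where a regular generator gains a degree because one of its
powers kills Čech cohomology.

Regularity of the generic forms is first local. After inverting a generator σ_t, the equation f_l =
0 can be solved for the coefficient of the monomial of f_l in X_{1,t₁}, …, X_{s,t_s}, since that
monomial becomes a unit. Eliminating these coefficients for l < k maps C to its fraction field,
kills the earlier forms and fixes f_k ≠ 0. Hence f_k x ∈ (f_l, l < k) forces σ_t^N x ∈ (f_l, l < k)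
for some exponent N depending on t (`exists_sigmaMonomial_pow_mul_mem`).

Local becomes global through H⁰: as long as k < N, exactness of the Čech complex of C/I_k in degrees
< N - k says that nothing nonzero is killed by powers of all the σ_t. So f_{k+1} is regular on
C/I_k, and `CechExact.quotient_sup` passes to C/I_{k+1} with one degree less
(`cechExact_quotient_genericForm`). -/

/-! ### Acyclicity of the Koszul complex of a regular sequence -/

section KoszulAcyclic

variable {R : Type u} [CommRing R] {ι : Type*} [LinearOrder ι]

/-- The Koszul differential of the subfamily of `a` indexed by `T`, on families indexed by all
finite sets. -/
def koszulSum (T : Finset ι) (a : ι → R) (m : Finset ι → R) (J : Finset ι) : R :=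
  ∑ k ∈ T \ J, insertionSign R J k * a k * m (insert k J)

theorem insertionSign_of_forall_lt {J : Finset ι} {k : ι} (h : ∀ x ∈ J, x < k) :
    insertionSign R J k = (-1) ^ J.card := by
  rw [insertionSign, Finset.filter_true_of_mem h]

theorem insertionSign_insert_of_lt {J : Finset ι} {k l : ι} (h : l < k) :
    insertionSign R (insert k J) l = insertionSign R J l := by
  rw [insertionSign, Finset.filter_insert, if_neg (not_lt.2 h.le), insertionSign]

/-- With `koszulSum_insert_insert`, this exhibits the Koszul complex on `insert k T` as the mapping
cone of multiplication by `a k` on the one for `T`. Taking `k` maximal makes the sign depend only on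
the degree. -/
theorem koszulSum_insert_of_subset {T J : Finset ι} {k : ι} (hk : ∀ x ∈ T, x < k) (hJ : J ⊆ T)
    (a : ι → R) (m : Finset ι → R) :
    koszulSum (insert k T) a m J =
      koszulSum T a m J + (-1) ^ J.card * a k * m (insert k J) := by
  have hkT : k ∉ T := fun h => lt_irrefl _ (hk k h)
  have hkJ : k ∉ J := fun h => hkT (hJ h)
  rw [koszulSum, Finset.insert_sdiff_of_notMem _ hkJ, Finset.sum_insert (by simp [hkT]),
    insertionSign_of_forall_lt (fun x hx => hk x (hJ hx)), add_comm]
  rfl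

theorem koszulSum_insert_insert {T J : Finset ι} {k : ι} (hk : ∀ x ∈ T, x < k)
    (a : ι → R) (m : Finset ι → R) :
    koszulSum (insert k T) a m (insert k J) = koszulSum T a (fun I => m (insert k I)) J := by
  have hkT : k ∉ T := fun h => lt_irrefl _ (hk k h)
  have h : insert k T \ insert k J = T \ J := by
    ext x
    simp only [Finset.mem_sdiff, Finset.mem_insert]
    constructor
    · rintro ⟨h | h, h'⟩
      · exact absurd (Or.inl h) h'
      · exact ⟨h, fun h'' => h' (Or.inr h'')⟩
    · rintro ⟨h, h'⟩
      exact ⟨Or.inr h, fun h'' => h''.elim (fun e => hkT (e ▸ h)) h'⟩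
  rw [koszulSum, h, koszulSum]
  refine Finset.sum_congr rfl fun l hl => ?_
  rw [insertionSign_insert_of_lt (hk l (Finset.mem_sdiff.1 hl).1), Finset.insert_comm]

theorem koszulSum_congr {T J : Finset ι} (a : ι → R) {m m' : Finset ι → R}
    (h : ∀ k ∈ T \ J, m (insert k J) = m' (insert k J)) :
    koszulSum T a m J = koszulSum T a m' J :=
  Finset.sum_congr rfl fun k hk => by rw [h k hk]

theorem koszulSum_add_smul (T J : Finset ι) (a : ι → R) (m m' : Finset ι → R) (c : R) :
    koszulSum T a (fun I => m I + c * m' I) J =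
      koszulSum T a m J + c * koszulSum T a m' J := by
  simp only [koszulSum, Finset.mul_sum, ← Finset.sum_add_distrib]
  exact Finset.sum_congr rfl fun k _ => by ring

theorem koszulSum_empty (T : Finset ι) (a : ι → R) (m : Finset ι → R) :
    koszulSum T a m ∅ = ∑ k ∈ T, a k * m {k} := by
  simp [koszulSum, insertionSign]

/-- The Koszul complex of a weakly regular sequence is exact in positive degrees. -/
theorem exists_koszulSum_eq (a : ι → R) (T : Finset ι)
    (ha : ∀ k ∈ T, ∀ x, a k * x ∈ Ideal.span (a '' {l | l ∈ T ∧ l < k}) →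
      x ∈ Ideal.span (a '' {l | l ∈ T ∧ l < k})) (p : ℕ) (m : Finset ι → R)
    (hm : ∀ J ⊆ T, J.card = p → koszulSum T a m J = 0) :
    ∃ w : Finset ι → R, ∀ J ⊆ T, J.card = p + 1 → koszulSum T a w J = m J := by
  induction T using Finset.induction_on_max generalizing p m with
  | empty =>
    refine ⟨0, fun J hJ hc => ?_⟩
    rw [Finset.subset_empty.1 hJ] at hc
    simp at hc
  | insert k T hk ih =>
    have hkT : k ∉ T := fun h => lt_irrefl _ (hk k h)
    -- Adjoining a larger index does not change the predecessors of elements of T, so the regularity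
    -- hypothesis restricts to T.
    have hlow : ∀ i ∈ T, {l | l ∈ insert k T ∧ l < i} = {l | l ∈ T ∧ l < i} := by
      intro i hi
      ext l
      simp only [Finset.mem_insert, Set.mem_ofPred_eq]
      constructor
      · rintro ⟨h | h, h'⟩
        · exact absurd (h ▸ h') (not_lt.2 (hk i hi).le)
        · exact ⟨h, h'⟩
      · exact fun h => ⟨Or.inr h.1, h.2⟩
    have hlow' : {l | l ∈ insert k T ∧ l < k} = (T : Set ι) := by
      ext l
      simp only [Finset.mem_insert, Set.mem_ofPred_eq, Finset.mem_coe]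
      exact ⟨fun h => h.1.resolve_left h.2.ne, fun h => ⟨Or.inr h, hk l h⟩⟩
    have ih' := ih fun i hi x hx => by
      have := ha i (Finset.mem_insert_of_mem hi) x
      rw [hlow i hi] at this
      exact this hx
    have hak := ha k (Finset.mem_insert_self _ _)
    rw [hlow'] at hak
    have hm1 : ∀ J ⊆ T, J.card = p →
        koszulSum T a m J + (-1) ^ p * a k * m (insert k J) = 0 := by
      intro J hJ hc
      rw [← hc, ← koszulSum_insert_of_subset hk hJ]
      exact hm J (hJ.trans (Finset.subset_insert _ _)) hc
    -- The component of the cycle along e_k is a boundary for T. In positive degree it is a cycle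
    -- and induction applies; in degree 0 this is exactly the regularity of `a k` modulo the earlier
    -- elements.
    obtain ⟨w₂, hw₂⟩ : ∃ w : Finset ι → R, ∀ J ⊆ T, J.card = p →
        koszulSum T a w J = m (insert k J) := by
      cases p with
      | zero =>
        have h0 := hm1 ∅ (Finset.empty_subset _) rfl
        rw [koszulSum_empty, pow_zero, one_mul] at h0
        have h1 : a k * m (insert k ∅) ∈ Ideal.span (a '' (T : Set ι)) := by
          rw [eq_neg_of_add_eq_zero_right h0]
          refine neg_mem (Ideal.sum_mem _ fun l hl => Ideal.mul_mem_right _ _ ?_)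
          exact Ideal.subset_span ⟨l, hl, rfl⟩
        have h2 := hak _ h1
        obtain ⟨c, hc⟩ := (Submodule.mem_span_image_finset_iff_exists_fun R).1 h2
        -- Only the values on singletons {l} matter, where the sum is the coefficient c l.
        refine ⟨fun I => ∑ l ∈ I, if h : l ∈ T then c ⟨l, h⟩ else 0, fun J _ hJ => ?_⟩
        rw [Finset.card_eq_zero.1 hJ, koszulSum_empty, ← hc, ← Finset.sum_coe_sort]
        exact Finset.sum_congr rfl fun l _ => by simp [mul_comm]
      | succ q =>
        refine ih' q (fun I => m (insert k I)) fun J hJ hc => ?_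
        rw [← koszulSum_insert_insert hk]
        refine hm _ (Finset.insert_subset_insert _ hJ) ?_
        rw [Finset.card_insert_of_notMem (fun h => hkT (hJ h)), hc]
    -- The correction by w₂ turns the part of m supported on T into a cycle; gluing w₁ and w₂
    -- cancels it again, with the opposite sign (-1)^(p+1).
    obtain ⟨w₁, hw₁⟩ := ih' p (fun I => m I + (-1) ^ p * a k * w₂ I) fun J hJ hc => by
      rw [koszulSum_add_smul, hw₂ J hJ hc, hm1 J hJ hc]
    refine ⟨fun I => if k ∈ I then w₂ (I.erase k) else w₁ I, fun J hJ hc => ?_⟩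
    by_cases hkJ : k ∈ J
    · obtain ⟨J', hkJ', rfl⟩ : ∃ J', k ∉ J' ∧ insert k J' = J :=
        ⟨J.erase k, Finset.notMem_erase _ _, Finset.insert_erase hkJ⟩
      have hJ' : J' ⊆ T := (Finset.insert_subset_insert_iff hkJ').1 hJ
      rw [Finset.card_insert_of_notMem hkJ', add_left_inj] at hc
      rw [koszulSum_insert_insert hk, ← hw₂ J' hJ' hc]
      refine koszulSum_congr a fun l hl => ?_
      have hkl : k ∉ insert l J' := by
        simp only [Finset.mem_insert, not_or]
        exact ⟨fun e => hkT (e ▸ (Finset.mem_sdiff.1 hl).1), hkJ'⟩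
      simp [Finset.erase_insert hkl]
    · have hJ' : J ⊆ T := (Finset.subset_insert_iff_of_notMem hkJ).1 hJ
      rw [koszulSum_insert_of_subset hk hJ', hc, if_pos (Finset.mem_insert_self _ _),
        Finset.erase_insert hkJ]
      have h1 := hw₁ J hJ' hc
      have h2 : koszulSum T a (fun I => if k ∈ I then w₂ (I.erase k) else w₁ I) J =
          koszulSum T a w₁ J := by
        refine koszulSum_congr a fun l hl => if_neg ?_
        simp only [Finset.mem_insert, not_or]
        exact ⟨fun e => hkT (e ▸ (Finset.mem_sdiff.1 hl).1), hkJ⟩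
      rw [h2, h1, pow_succ]
      ring

theorem koszulD_eq_koszulSum {r : ℕ} (a : Fin r → R) (p : ℕ) (m : Finset (Fin r) → R)
    (J : {I : Finset (Fin r) // I.card = p}) :
    koszulD a p (fun I => m I.1) J = koszulSum Finset.univ a m J.1 := by
  rw [koszulD_apply, koszulSum]
  exact (Finset.sum_subtype (Finset.univ \ J.1) (by simp)
    (fun k => insertionSign R J.1 k * a k * m (insert k J.1))).symm

theorem isZero_homology_koszulComplex {r : ℕ} (a : Fin r → R)
    (ha : ∀ k x, a k * x ∈ Ideal.span (a '' {l | l < k}) → x ∈ Ideal.span (a '' {l | l < k}))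
    {p : ℕ} (hp : p ≠ 0) : CategoryTheory.Limits.IsZero ((koszulComplex a).homology p) := by
  obtain ⟨q, rfl⟩ := Nat.exists_eq_succ_of_ne_zero hp
  rw [← HomologicalComplex.exactAt_iff_isZero_homology,
    HomologicalComplex.exactAt_iff' _ (q + 2) (q + 1) q (by simp) (by simp),
    CategoryTheory.ShortComplex.moduleCat_exact_iff]
  intro (m : KoszulModule R r (q + 1)) hm
  have hd : ∀ p, (koszulComplex a).d (p + 1) p = ModuleCat.ofHom (koszulD a p) :=
    fun p => ChainComplex.of_d (fun p => ModuleCat.of R (KoszulModule R r p))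
      (fun p => ModuleCat.ofHom (koszulD a p)) p
  have hm' : koszulD a q m = 0 := (congrArg (fun g => g.hom m) (hd q)).symm.trans hm
  obtain ⟨m', rfl⟩ : ∃ m' : Finset (Fin r) → R, (fun I => m' I.1) = m :=
    ⟨fun I => if h : I.card = q + 1 then m ⟨I, h⟩ else 0, by
      funext I
      simp [I.2]⟩
  obtain ⟨w, hw⟩ := exists_koszulSum_eq a Finset.univ (by simpa using ha) q m' fun J _ hJ => by
    rw [← koszulD_eq_koszulSum a q m' ⟨J, hJ⟩, hm']
    rfl
  have key : koszulD a (q + 1) (fun I => w I.1) = fun I => m' I.1 := by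
    funext J
    rw [koszulD_eq_koszulSum, hw J.1 (Finset.subset_univ _) J.2]
  exact ⟨(fun I => w I.1 : KoszulModule R r (q + 2)),
    (congrArg (fun g => g.hom (fun I => w I.1 : KoszulModule R r (q + 2))) (hd (q + 1))).trans key⟩

end KoszulAcyclic

/-! ### Exactness of the augmented Čech complex in low degrees -/

section CechExact

variable {R : Type u} [CommRing R] {ι : Type} [LinearOrder ι] (a : ι → R)

/-! ### Exactness of localization and clearing of denominators -/

section Functoriality

variable {M : Type u} [AddCommGroup M] [Module R M] {M' : Type u} [AddCommGroup M'] [Module R M']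

/-- The map `M_{a_I} → M'_{a_I}` induced by a linear map `M → M'`. -/
noncomputable def cechLocMap (φ : M →ₗ[R] M') (I : Finset ι) :
    CechLoc a M I →ₗ[R] CechLoc a M' I :=
  IsLocalizedModule.map (Submonoid.powers (∏ i ∈ I, a i)) (LocalizedModule.mkLinearMap _ M)
    (LocalizedModule.mkLinearMap _ M') φ

theorem cechLocMap_comp_mk (φ : M →ₗ[R] M') (I : Finset ι) :
    cechLocMap a φ I ∘ₗ LocalizedModule.mkLinearMap _ M =
      LocalizedModule.mkLinearMap _ M' ∘ₗ φ :=
  IsLocalizedModule.map_comp _ _ _ _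

theorem cechRes_mk {I J : Finset ι} (h : I ⊆ J) (x : M) :
    cechRes a M h (LocalizedModule.mkLinearMap _ M x) = LocalizedModule.mkLinearMap _ M x :=
  LinearMap.congr_fun (cechRes_comp_mk a M h) x

theorem cechRes_cechRes {I J L : Finset ι} (h : I ⊆ J) (h' : J ⊆ L) (x : CechLoc a M I) :
    cechRes a M h' (cechRes a M h x) = cechRes a M (h.trans h') x :=
  LinearMap.congr_fun (cechRes_comp a M h h') x

theorem cechLocMap_cechRes (φ : M →ₗ[R] M') {I J : Finset ι} (h : I ⊆ J) (x : CechLoc a M I) :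
    cechLocMap a φ J (cechRes a M h x) = cechRes a M' h (cechLocMap a φ I x) := by
  refine LinearMap.congr_fun (f := cechLocMap a φ J ∘ₗ cechRes a M h)
    (g := cechRes a M' h ∘ₗ cechLocMap a φ I) ?_ x
  refine IsLocalizedModule.ext (Submonoid.powers (∏ i ∈ I, a i))
    (LocalizedModule.mkLinearMap _ M) (isUnit_cechLoc a M' h) ?_
  rw [LinearMap.comp_assoc, LinearMap.comp_assoc, cechRes_comp_mk, cechLocMap_comp_mk,
    cechLocMap_comp_mk, ← LinearMap.comp_assoc, cechRes_comp_mk]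

theorem cechLocMap_surjective {φ : M →ₗ[R] M'} (hφ : Function.Surjective φ) (I : Finset ι) :
    Function.Surjective (cechLocMap a φ I) :=
  IsLocalizedModule.map_surjective _ _ _ _ hφ

theorem exists_pow_smul_eq_mk (I : Finset ι) (z : CechLoc a M I) :
    ∃ (N : ℕ) (x : M), (∏ i ∈ I, a i) ^ N • z = LocalizedModule.mkLinearMap _ M x := by
  obtain ⟨⟨x, ⟨_, N, rfl⟩⟩, h⟩ := IsLocalizedModule.surj (Submonoid.powers (∏ i ∈ I, a i))
    (LocalizedModule.mkLinearMap _ M) z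
  exact ⟨N, x, h⟩

theorem mk_eq_zero_iff (I : Finset ι) (x : M) :
    LocalizedModule.mkLinearMap (Submonoid.powers (∏ i ∈ I, a i)) M x = 0 ↔
      ∃ N : ℕ, (∏ i ∈ I, a i) ^ N • x = 0 := by
  rw [IsLocalizedModule.eq_zero_iff (Submonoid.powers (∏ i ∈ I, a i))]
  constructor
  · rintro ⟨⟨_, N, rfl⟩, h⟩
    exact ⟨N, h⟩
  · rintro ⟨N, h⟩
    exact ⟨⟨_, N, rfl⟩, h⟩

theorem pow_smul_cechLoc_injective {I J : Finset ι} (h : I ⊆ J) (N : ℕ) {z z' : CechLoc a M J}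
    (hz : (∏ i ∈ I, a i) ^ N • z = (∏ i ∈ I, a i) ^ N • z') : z = z' :=
  ((Module.End.isUnit_iff _).1 (isUnit_cechLoc a M h ⟨_, N, rfl⟩)).1 hz

theorem exists_pow_smul_cechLoc_eq {I J : Finset ι} (h : I ⊆ J) (N : ℕ) (z : CechLoc a M J) :
    ∃ w, (∏ i ∈ I, a i) ^ N • w = z :=
  ((Module.End.isUnit_iff _).1 (isUnit_cechLoc a M h ⟨_, N, rfl⟩)).2 z

theorem smul_cechLoc_eq_zero {x : R} (hx : ∀ m : M, x • m = 0 → m = 0) (I : Finset ι)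
    {z : CechLoc a M I} (hz : x • z = 0) : z = 0 := by
  obtain ⟨N, m, hm⟩ := exists_pow_smul_eq_mk a I z
  have h1 : LocalizedModule.mkLinearMap (Submonoid.powers (∏ i ∈ I, a i)) M (x • m) = 0 := by
    rw [map_smul, ← hm, smul_comm, hz, smul_zero]
  obtain ⟨N', h2⟩ := (mk_eq_zero_iff a I _).1 h1
  rw [smul_comm] at h2
  have h3 := (mk_eq_zero_iff a I m).2 ⟨N', hx _ h2⟩
  rw [← hm] at h3
  exact pow_smul_cechLoc_injective a (subset_refl I) N (h3.trans (smul_zero _).symm)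

theorem exists_smul_eq_of_cechLocMap_eq_zero {φ : M →ₗ[R] M'} {x : R}
    (hφ : ∀ m, φ m = 0 → ∃ m', m = x • m') (I : Finset ι) {z : CechLoc a M I}
    (hz : cechLocMap a φ I z = 0) : ∃ w, z = x • w := by
  obtain ⟨N, m, hm⟩ := exists_pow_smul_eq_mk a I z
  have h1 : LocalizedModule.mkLinearMap (Submonoid.powers (∏ i ∈ I, a i)) M' (φ m) = 0 := by
    have := LinearMap.congr_fun (cechLocMap_comp_mk a φ I) m
    rw [LinearMap.comp_apply, ← hm, map_smul, hz, smul_zero] at this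
    exact this.symm
  obtain ⟨N', h2⟩ := (mk_eq_zero_iff a I _).1 h1
  rw [← map_smul] at h2
  obtain ⟨m', h3⟩ := hφ _ h2
  obtain ⟨w, hw⟩ := exists_pow_smul_cechLoc_eq a (subset_refl I) (N' + N)
    (LocalizedModule.mkLinearMap (Submonoid.powers (∏ i ∈ I, a i)) M m')
  refine ⟨w, pow_smul_cechLoc_injective a (subset_refl I) (N' + N) ?_⟩
  rw [smul_comm _ x, hw, ← map_smul, ← h3, map_smul, ← hm, smul_smul, pow_add]

theorem cechLocMap_smul_eq_zero {φ : M →ₗ[R] M'} {x : R} (hφ : ∀ m, φ (x • m) = 0)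
    {I : Finset ι} (z : CechLoc a M I) : cechLocMap a φ I (x • z) = 0 := by
  obtain ⟨N, y, hy⟩ := exists_pow_smul_eq_mk a I z
  refine pow_smul_cechLoc_injective a (subset_refl I) N ?_
  rw [← map_smul, smul_comm, hy, ← map_smul, ← LinearMap.comp_apply (cechLocMap a φ I),
    cechLocMap_comp_mk, LinearMap.comp_apply, hφ, map_zero, smul_zero]

theorem cechRes_insert_eq_zero {i : ι} (hi : ∀ m : M, a i • m = 0 → m = 0) {I : Finset ι}
    (hI : i ∉ I) {z : CechLoc a M I} (hz : cechRes a M (Finset.subset_insert i I) z = 0) :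
    z = 0 := by
  obtain ⟨N, m, hm⟩ := exists_pow_smul_eq_mk a I z
  have h1 : LocalizedModule.mkLinearMap (Submonoid.powers (∏ j ∈ insert i I, a j)) M m = 0 := by
    rw [← cechRes_mk a (Finset.subset_insert i I), ← hm, map_smul, hz, smul_zero]
  obtain ⟨N', h2⟩ := (mk_eq_zero_iff a _ _).1 h1
  rw [Finset.prod_insert hI, mul_pow, mul_smul] at h2
  have h4 : ∀ (n : ℕ) (y : M), a i ^ n • y = 0 → y = 0 := by
    intro n
    induction n with
    | zero => simp
    | succ n ih => exact fun y hy => ih y (hi _ (by rwa [smul_smul, ← pow_succ']))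
  have h3 := (mk_eq_zero_iff a I m).2 ⟨N', h4 _ _ h2⟩
  rw [← hm] at h3
  exact pow_smul_cechLoc_injective a (subset_refl I) N (h3.trans (smul_zero _).symm)

/-- Clears the `a i` part of the denominator. All large exponents are allowed so that one exponent
can later serve every index set at once. -/
theorem exists_cechRes_insert_eq {i : ι} {I : Finset ι} (hI : i ∉ I)
    (z : CechLoc a M (insert i I)) :
    ∃ N : ℕ, ∀ N' ≥ N, ∃ w, cechRes a M (Finset.subset_insert i I) w = a i ^ N' • z := by
  obtain ⟨N, m, hm⟩ := exists_pow_smul_eq_mk a _ z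
  refine ⟨N, fun N' hN' => ?_⟩
  obtain ⟨w, hw⟩ := exists_pow_smul_cechLoc_eq a (subset_refl I) N
    (LocalizedModule.mkLinearMap (Submonoid.powers (∏ i ∈ I, a i)) M m)
  obtain ⟨e, rfl⟩ := Nat.exists_eq_add_of_le hN'
  refine ⟨a i ^ e • w, pow_smul_cechLoc_injective a (Finset.subset_insert i I) N ?_⟩
  rw [map_smul, smul_comm, ← map_smul, hw, cechRes_mk, ← hm, smul_smul, smul_smul]
  congr 1
  rw [Finset.prod_insert hI]
  ring

end Functoriality

/-! ### Čech cohomology and regular elements -/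

variable {M : Type u} [AddCommGroup M] [Module R M] {M' : Type u} [AddCommGroup M'] [Module R M']

/-- The Čech differential on families indexed by all finite sets. -/
noncomputable def cechSum (m : ∀ I : Finset ι, CechLoc a M I) (J : Finset ι) : CechLoc a M J :=
  ∑ j ∈ J, insertionSign R J j • cechRes a M (Finset.erase_subset j J) (m (J.erase j))

theorem cechD_eq_cechSum (p : ℕ) (m : ∀ I : Finset ι, CechLoc a M I)
    (J : {I : Finset ι // I.card = p + 1}) :
    cechD a M p (fun I => m I.1) J = cechSum a m J.1 := by
  rw [cechD_apply, cechSum]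
  exact Finset.sum_coe_sort J.1 (fun j => insertionSign R J.1 j •
    cechRes a M (Finset.erase_subset j J.1) (m (J.1.erase j)))

theorem cechSum_congr {m m' : ∀ I : Finset ι, CechLoc a M I} {J : Finset ι} {p : ℕ}
    (hJ : J.card = p + 1) (h : ∀ I, I.card = p → m I = m' I) : cechSum a m J = cechSum a m' J :=
  Finset.sum_congr rfl fun j hj => by
    rw [h _ (by rw [Finset.card_erase_of_mem hj, hJ, Nat.add_sub_cancel])]

theorem cechSum_add (m m' : ∀ I : Finset ι, CechLoc a M I) (J : Finset ι) :
    cechSum a (fun I => m I + m' I) J = cechSum a m J + cechSum a m' J := by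
  simp only [cechSum, map_add, smul_add, Finset.sum_add_distrib]

theorem cechSum_smul (c : R) (m : ∀ I : Finset ι, CechLoc a M I) (J : Finset ι) :
    cechSum a (fun I => c • m I) J = c • cechSum a m J := by
  simp only [cechSum, map_smul, Finset.smul_sum, smul_comm c]

theorem cechSum_sub (m m' : ∀ I : Finset ι, CechLoc a M I) (J : Finset ι) :
    cechSum a (fun I => m I - m' I) J = cechSum a m J - cechSum a m' J := by
  simp only [cechSum, map_sub, smul_sub, Finset.sum_sub_distrib]

theorem cechSum_cechLocMap (φ : M →ₗ[R] M') (m : ∀ I : Finset ι, CechLoc a M I) (J : Finset ι) :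
    cechSum a (fun I => cechLocMap a φ I (m I)) J = cechLocMap a φ J (cechSum a m J) := by
  simp only [cechSum, map_sum, map_smul, cechLocMap_cechRes]

theorem cechSum_empty (m : ∀ I : Finset ι, CechLoc a M I) : cechSum a m ∅ = 0 :=
  Finset.sum_empty

theorem cechSum_cechSum (m : ∀ I : Finset ι, CechLoc a M I) (J : Finset ι) :
    cechSum a (cechSum a m) J = 0 := by
  obtain h | h | ⟨p, h⟩ : J.card = 0 ∨ J.card = 1 ∨ ∃ p, J.card = p + 1 + 1 := by
    rcases h : J.card with _ | _ | p
    · exact Or.inl rfl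
    · exact Or.inr (Or.inl rfl)
    · exact Or.inr (Or.inr ⟨p, rfl⟩)
  · rw [Finset.card_eq_zero.1 h, cechSum_empty]
  · obtain ⟨j, rfl⟩ := Finset.card_eq_one.1 h
    rw [cechSum_congr a (m' := fun _ => 0) (p := 0) h
      (fun I hI => by rw [Finset.card_eq_zero.1 hI, cechSum_empty])]
    simp [cechSum]
  · have h1 : cechD a M p (fun I => m I.1 : CechModule a M p) =
        (fun I => cechSum a m I.1 : CechModule a M (p + 1)) :=
      funext (fun I => cechD_eq_cechSum a p m I)
    have h2 := LinearMap.congr_fun (cechD_comp a M p) (fun I => m I.1 : CechModule a M p)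
    rw [LinearMap.comp_apply, h1] at h2
    rw [← cechD_eq_cechSum a (p + 1) _ ⟨J, h⟩, h2]
    rfl

variable (M) in
/-- The augmented Čech complex of `M` is exact in degrees `< k`. -/
def CechExact (k : ℕ) : Prop :=
  ∀ p < k, ∀ m : ∀ I : Finset ι, CechLoc a M I, (∀ J, J.card = p + 1 → cechSum a m J = 0) →
    ∃ w, ∀ J, J.card = p → cechSum a w J = m J

variable {a}

/-- The long exact sequence of 0 → M → M → M' → 0 (first map multiplication by `x`), as a chase:
lift the cocycle to m, write dm = x u, find u = dw since u is a cocycle by regularity, and m - x w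
is a cocycle, hence dv. The use of exactness one degree higher, for u, accounts for the loss of a
degree. -/
theorem CechExact.of_surjective {φ : M →ₗ[R] M'} (hφ : Function.Surjective φ) {x : R}
    (hker : ∀ m, φ m = 0 → ∃ m', m = x • m') (hφx : ∀ m, φ (x • m) = 0)
    (hx : ∀ m : M, x • m = 0 → m = 0) {k : ℕ} (h : CechExact a M (k + 1)) : CechExact a M' k := by
  intro p hp m' hm'
  choose m hm using fun I => cechLocMap_surjective a hφ I (m' I)
  obtain rfl : m' = fun I => cechLocMap a φ I (m I) := funext fun I => (hm I).symm
  have h1 : ∀ J : Finset ι, ∃ u, J.card = p + 1 → cechSum a m J = x • u := by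
    intro J
    by_cases hJ : J.card = p + 1
    · obtain ⟨u, hu⟩ := exists_smul_eq_of_cechLocMap_eq_zero a hker J
        ((cechSum_cechLocMap a φ m J).symm.trans (hm' J hJ))
      exact ⟨u, fun _ => hu⟩
    · exact ⟨0, fun h => absurd h hJ⟩
  choose u hu using h1
  obtain ⟨w, hw⟩ := h (p + 1) (by omega) u fun J hJ => by
    refine smul_cechLoc_eq_zero a hx J ?_
    rw [← cechSum_smul, ← cechSum_congr a hJ hu, cechSum_cechSum]
  obtain ⟨v, hv⟩ := h p (by omega) (fun I => m I - x • w I) fun J hJ => by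
    rw [cechSum_sub, cechSum_smul, hw J hJ, hu J hJ, sub_self]
  refine ⟨fun I => cechLocMap a φ I (v I), fun J hJ => ?_⟩
  rw [cechSum_cechLocMap, hv J hJ, map_sub]
  rw [cechLocMap_smul_eq_zero a hφx, sub_zero]

/-- A power of `a i` annihilates the Čech cohomology. -/
theorem exists_cechSum_eq_pow_smul [Finite ι] {i : ι} (hi : ∀ m : M, a i • m = 0 → m = 0) (p : ℕ)
    (m : ∀ I : Finset ι, CechLoc a M I) (hm : ∀ J, J.card = p + 1 → cechSum a m J = 0) :
    ∃ (N : ℕ) (w : ∀ I : Finset ι, CechLoc a M I),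
      ∀ J, J.card = p → cechSum a w J = a i ^ N • m J := by
  have h1 : ∀ I : Finset ι, ∃ N : ℕ, i ∉ I → ∀ N' ≥ N, ∃ w,
      cechRes a M (Finset.subset_insert i I) w = a i ^ N' • m (insert i I) := by
    intro I
    by_cases hI : i ∈ I
    · exact ⟨0, fun h => absurd hI h⟩
    · obtain ⟨N, hN⟩ := exists_cechRes_insert_eq a hI (m (insert i I))
      exact ⟨N, fun _ => hN⟩
  choose n hn using h1
  obtain ⟨N, hN⟩ := (Set.finite_range n).bddAbove
  -- The contracting homotopy available when `a i` is invertible, m ↦ ± m_{I ∪ {i}}, multiplied by a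
  -- power of `a i` large enough for it to land in M_{a_I}.
  have h2 : ∀ I : Finset ι, ∃ w, (i ∈ I → w = 0) ∧ (i ∉ I →
      cechRes a M (Finset.subset_insert i I) w =
        insertionSign R I i • a i ^ N • m (insert i I)) := by
    intro I
    by_cases hI : i ∈ I
    · exact ⟨0, fun _ => rfl, fun h => absurd hI h⟩
    · obtain ⟨w, hw⟩ := hn I hI N (hN ⟨I, rfl⟩)
      exact ⟨insertionSign R I i • w, fun h => absurd h hI, fun _ => by rw [map_smul, hw]⟩
  choose w hw0 hw using h2
  have hsq : ∀ (J : Finset ι) (j : ι), insertionSign R J j * insertionSign R J j = 1 := by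
    intro J j
    rw [insertionSign, ← mul_pow]
    simp
  have hcongr : ∀ {I I' J : Finset ι} (_ : I = I') (h : I ⊆ J) (h' : I' ⊆ J),
      cechRes a M h (m I) = cechRes a M h' (m I') := by
    rintro I _ J rfl h h'
    rfl
  refine ⟨N, w, fun J hJ => ?_⟩
  by_cases hiJ : i ∈ J
  -- Every other term is w on a set still containing i, hence zero.
  · rw [cechSum, Finset.sum_eq_single_of_mem i hiJ]
    · obtain ⟨I, hI, rfl⟩ : ∃ I, i ∉ I ∧ insert i I = J :=
        ⟨J.erase i, Finset.notMem_erase _ _, Finset.insert_erase hiJ⟩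
      have h3 : ∀ (I' : Finset ι) (h : I' ⊆ insert i I), I' = I → cechRes a M h (w I') =
          insertionSign R I i • a i ^ N • m (insert i I) := by
        rintro I' h rfl
        exact hw _ hI
      rw [h3 _ _ (Finset.erase_insert hI), insertionSign, Finset.filter_insert,
        if_neg (lt_irrefl i), ← insertionSign, smul_smul, hsq, one_smul]
    · intro j _ hji
      rw [hw0 _ (Finset.mem_erase.2 ⟨Ne.symm hji, hiJ⟩), map_zero, smul_zero]
  · rw [← sub_eq_zero]
    -- Since `a i` is regular, the identity may be checked after localizing at it as well, where it
    -- becomes the cocycle condition at `insert i J`.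
    refine cechRes_insert_eq_zero a hi hiJ ?_
    have h3 := hm (insert i J) (by rw [Finset.card_insert_of_notMem hiJ, hJ])
    rw [cechSum, Finset.sum_insert hiJ,
      hcongr (Finset.erase_insert hiJ) _ (Finset.subset_insert i J)] at h3
    have h4 : insertionSign R (insert i J) i = insertionSign R J i := by
      rw [insertionSign, Finset.filter_insert, if_neg (lt_irrefl i), ← insertionSign]
    rw [h4] at h3
    have h5 : cechRes a M (Finset.subset_insert i J) (cechSum a w J) =
        -(insertionSign R J i * a i ^ N) • ∑ j ∈ J, insertionSign R (insert i J) j •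
          cechRes a M (Finset.erase_subset j (insert i J)) (m ((insert i J).erase j)) := by
      rw [cechSum, map_sum, Finset.smul_sum]
      refine Finset.sum_congr rfl fun j hj => ?_
      have hji : j ≠ i := fun e => hiJ (e ▸ hj)
      have hij : i ∉ J.erase j := fun h => hiJ (Finset.mem_of_mem_erase h)
      have h6 : insertionSign R J j * insertionSign R (J.erase j) i =
          -(insertionSign R J i * insertionSign R (insert i J) j) := by
        have h7 := insertionSign_erase_mul (R := R) (insert i J) (Finset.mem_insert_self i J)
          (Finset.mem_insert_of_mem hj) hji.symm
        rw [Finset.erase_insert hiJ, h4, Finset.erase_insert_of_ne hji.symm] at h7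
        have h8 : insertionSign R (insert i (J.erase j)) i = insertionSign R (J.erase j) i := by
          rw [insertionSign, Finset.filter_insert, if_neg (lt_irrefl i), ← insertionSign]
        rw [h8] at h7
        have h10 := hsq J j
        have h11 := hsq (insert i J) j
        linear_combination (insertionSign R J j * insertionSign R (insert i J) j) * h7 -
          (insertionSign R J i * insertionSign R (insert i J) j) * h10 -
          (insertionSign R J j * insertionSign R (J.erase j) i) * h11
      have h7 : cechRes a M ((Finset.erase_subset j J).trans (Finset.subset_insert i J))
          (w (J.erase j)) = (insertionSign R (J.erase j) i * a i ^ N) •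
          cechRes a M (Finset.erase_subset j (insert i J)) (m ((insert i J).erase j)) := by
        rw [← cechRes_cechRes a (Finset.subset_insert i (J.erase j))
          (Finset.insert_subset_insert i (Finset.erase_subset j J)), hw _ hij, map_smul, map_smul,
          smul_smul]
        congr 1
        exact hcongr (Finset.erase_insert_of_ne hji.symm).symm _ _
      rw [map_smul, cechRes_cechRes, h7, smul_smul, smul_smul]
      congr 1
      linear_combination (a i ^ N) * h6
    rw [map_sub, h5, eq_neg_of_add_eq_zero_right h3, map_smul, smul_neg, neg_smul, neg_neg,
      smul_smul, mul_right_comm, hsq, one_mul, sub_self]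

/-- Vanishing of H^{p-1}(M') makes multiplication by `a i` injective on H^p(M), while a power of `a
i` kills every class; so H^p(M) = 0. The induction on the exponent N strips off one factor `a i` at
a time. -/
theorem CechExact.of_quotient [Finite ι] {φ : M →ₗ[R] M'} {i : ι}
    (hφ : Function.Surjective φ)
    (hker : ∀ m, φ m = 0 → ∃ m', m = a i • m') (hφx : ∀ m, φ (a i • m) = 0)
    (hi : ∀ m : M, a i • m = 0 → m = 0) {k : ℕ} (h : CechExact a M' k) : CechExact a M (k + 1) := by
  intro p hp m hm
  obtain ⟨N, hN⟩ := exists_cechSum_eq_pow_smul hi p m hm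
  induction N with
  | zero => simpa using hN
  | succ N ih =>
    apply ih
    obtain ⟨w, hw⟩ := hN
    cases p with
    | zero =>
      refine ⟨w, fun J hJ => ?_⟩
      have h1 := hw J hJ
      rw [Finset.card_eq_zero.1 hJ, cechSum_empty] at h1 ⊢
      rw [pow_succ', mul_smul] at h1
      exact (smul_cechLoc_eq_zero a hi _ h1.symm).symm
    | succ q =>
      -- Modulo `a i` the cochain w is a cocycle, hence a coboundary; so w = dv + a_i u, and u is a
      -- primitive with one factor `a i` fewer.
      obtain ⟨v', hv'⟩ := h q (by omega) (fun I => cechLocMap a φ I (w I)) fun J hJ => by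
        rw [cechSum_cechLocMap, hw J hJ, pow_succ', mul_smul, cechLocMap_smul_eq_zero a hφx]
      choose v hv using fun I => cechLocMap_surjective a hφ I (v' I)
      obtain rfl : v' = fun I => cechLocMap a φ I (v I) := funext fun I => (hv I).symm
      have h1 : ∀ J : Finset ι, ∃ u, J.card = q → w J = cechSum a v J + a i • u := by
        intro J
        by_cases hJ : J.card = q
        · obtain ⟨u, hu⟩ := exists_smul_eq_of_cechLocMap_eq_zero a hker J
            (z := w J - cechSum a v J)
            (by rw [map_sub, ← cechSum_cechLocMap, hv' J hJ, sub_self])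
          exact ⟨u, fun _ => by rw [← hu, add_sub_cancel]⟩
        · exact ⟨0, fun h => absurd h hJ⟩
      choose u hu using h1
      refine ⟨u, fun J hJ => ?_⟩
      have h2 := hw J hJ
      rw [cechSum_congr a hJ hu, cechSum_add, cechSum_cechSum, zero_add, cechSum_smul, pow_succ',
        mul_smul, ← sub_eq_zero, ← smul_sub] at h2
      exact sub_eq_zero.1 (smul_cechLoc_eq_zero a hi J h2)

/-- An element killed by powers of all the `a i` is a degree 0 cocycle, and there are no nonzero
coboundaries in degree 0. -/
theorem CechExact.eq_zero {k : ℕ} (h : CechExact a M k) (hk : 0 < k) {x : M}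
    (hx : ∀ i, ∃ N : ℕ, a i ^ N • x = 0) : x = 0 := by
  obtain ⟨w, hw⟩ := h 0 hk (fun I => LocalizedModule.mkLinearMap _ M x) fun J hJ => by
    obtain ⟨j, rfl⟩ := Finset.card_eq_one.1 hJ
    rw [cechSum, Finset.sum_singleton, cechRes_mk, (mk_eq_zero_iff a {j} x).2, smul_zero]
    simpa using hx j
  have h1 := (hw ∅ rfl).symm
  rw [cechSum_empty, mk_eq_zero_iff] at h1
  simpa using h1

theorem CechExact.isZero_homology {k : ℕ} (h : CechExact a M k) {p : ℕ} (hp : p < k) :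
    CategoryTheory.Limits.IsZero ((augmentedCechComplex a M).homology p) := by
  have hd : ∀ p, (augmentedCechComplex a M).d p (p + 1) = ModuleCat.ofHom (cechD a M p) :=
    fun p => CochainComplex.of_d (fun p => ModuleCat.of R (CechModule a M p))
      (fun p => ModuleCat.ofHom (cechD a M p)) p
  have key : ∀ z : CechModule a M p, cechD a M p z = 0 → ∃ w : ∀ I, CechLoc a M I,
      ∀ J, cechSum a w J.1 = z J := by
    intro z hz
    obtain ⟨m, rfl⟩ : ∃ m : ∀ I : Finset ι, CechLoc a M I,
        (fun I => m I.1 : CechModule a M p) = z :=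
      ⟨fun I => if h : I.card = p then z ⟨I, h⟩ else 0, by
        funext I
        simp [I.2]⟩
    obtain ⟨w, hw⟩ := h p hp m fun J hJ => by
      rw [← cechD_eq_cechSum a p m ⟨J, hJ⟩, hz]
      rfl
    exact ⟨w, fun J => hw J.1 J.2⟩
  rw [← HomologicalComplex.exactAt_iff_isZero_homology]
  cases p with
  | zero =>
    rw [HomologicalComplex.exactAt_iff' _ 0 0 1 (by simp) (by simp),
      CategoryTheory.ShortComplex.moduleCat_exact_iff]
    intro (z : CechModule a M 0) hz
    obtain ⟨w, hw⟩ := key z ((congrArg (fun g => g.hom z) (hd 0)).symm.trans hz)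
    -- Nothing precedes degree 0, so the cocycle itself has to vanish.
    refine ⟨(0 : CechModule a M 0), (map_zero _).trans ?_⟩
    have h0 : z = 0 := by
      funext ⟨J, hJ⟩
      obtain rfl := Finset.card_eq_zero.1 hJ
      rw [← hw, cechSum_empty]
      rfl
    exact h0.symm
  | succ q =>
    rw [HomologicalComplex.exactAt_iff' _ q (q + 1) (q + 2) (by simp) (by simp),
      CategoryTheory.ShortComplex.moduleCat_exact_iff]
    intro (z : CechModule a M (q + 1)) hz
    obtain ⟨w, hw⟩ := key z ((congrArg (fun g => g.hom z) (hd (q + 1))).symm.trans hz)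
    refine ⟨(fun I => w I.1 : CechModule a M q),
      (congrArg (fun g => g.hom (fun I => w I.1 : CechModule a M q)) (hd q)).trans ?_⟩
    exact funext fun J => (cechD_eq_cechSum a q w J).trans (hw J)

end CechExact

/-! ### Quotients by weakly regular sequences -/

section Quotient

variable {R : Type u} [CommRing R] {ι : Type} [LinearOrder ι] {a : ι → R} {I I' : Ideal R} {x : R}

theorem factorₐ_eq_zero_of_sup (h : I ≤ I') (hI : I' = I ⊔ Ideal.span {x}) (m : R ⧸ I)
    (hm : (Ideal.Quotient.factorₐ R h).toLinearMap m = 0) : ∃ m', m = x • m' := by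
  obtain ⟨y, rfl⟩ := Ideal.Quotient.mk_surjective m
  have hy : y ∈ I' := Ideal.Quotient.eq_zero_iff_mem.1 hm
  rw [hI, Submodule.mem_sup] at hy
  obtain ⟨z, hz, w, hw, rfl⟩ := hy
  obtain ⟨c, rfl⟩ := Ideal.mem_span_singleton'.1 hw
  refine ⟨Ideal.Quotient.mk I c, ?_⟩
  rw [map_add, Ideal.Quotient.eq_zero_iff_mem.2 hz, zero_add, mul_comm]
  rfl

theorem factorₐ_smul_eq_zero (h : I ≤ I') (hx : x ∈ I') (m : R ⧸ I) :
    (Ideal.Quotient.factorₐ R h).toLinearMap (x • m) = 0 := by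
  obtain ⟨y, rfl⟩ := Ideal.Quotient.mk_surjective m
  exact Ideal.Quotient.eq_zero_iff_mem.2 (Ideal.mul_mem_right y I' hx)

theorem smul_quotient_eq_zero (hx : ∀ y, x * y ∈ I → y ∈ I) (m : R ⧸ I) (hm : x • m = 0) :
    m = 0 := by
  obtain ⟨y, rfl⟩ := Ideal.Quotient.mk_surjective m
  exact Ideal.Quotient.eq_zero_iff_mem.2 (hx y (Ideal.Quotient.eq_zero_iff_mem.1 hm))

theorem factorₐ_toLinearMap_surjective (h : I ≤ I') :
    Function.Surjective (Ideal.Quotient.factorₐ R h).toLinearMap :=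
  Ideal.Quotient.factor_surjective h

theorem CechExact.quotient_sup (hI : I' = I ⊔ Ideal.span {x}) (hx : ∀ y, x * y ∈ I → y ∈ I)
    {k : ℕ} (h : CechExact a (R ⧸ I) (k + 1)) : CechExact a (R ⧸ I') k := by
  have hle : I ≤ I' := hI ▸ le_sup_left
  have hxI : x ∈ I' := hI ▸ Ideal.mem_sup_right (Ideal.mem_span_singleton_self x)
  exact h.of_surjective (factorₐ_toLinearMap_surjective hle) (factorₐ_eq_zero_of_sup hle hI)
    (factorₐ_smul_eq_zero hle hxI) (smul_quotient_eq_zero hx)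

theorem CechExact.of_quotient_sup [Finite ι] {i : ι} (hI : I' = I ⊔ Ideal.span {a i})
    (hx : ∀ y, a i * y ∈ I → y ∈ I) {k : ℕ} (h : CechExact a (R ⧸ I') k) :
    CechExact a (R ⧸ I) (k + 1) := by
  have hle : I ≤ I' := hI ▸ le_sup_left
  have hxI : a i ∈ I' := hI ▸ Ideal.mem_sup_right (Ideal.mem_span_singleton_self _)
  exact h.of_quotient (factorₐ_toLinearMap_surjective hle) (factorₐ_eq_zero_of_sup hle hI)
    (factorₐ_smul_eq_zero hle hxI) (smul_quotient_eq_zero hx)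

theorem CechExact.mem_ideal {k : ℕ} (h : CechExact a (R ⧸ I) k) (hk : 0 < k) {x : R}
    (hx : ∀ i, ∃ N : ℕ, a i ^ N * x ∈ I) : x ∈ I := by
  refine Ideal.Quotient.eq_zero_iff_mem.1 (h.eq_zero hk fun i => ?_)
  obtain ⟨N, hN⟩ := hx i
  exact ⟨N, Ideal.Quotient.eq_zero_iff_mem.2 hN⟩

end Quotient

/-! ### The grade of `𝔐` on the polynomial ring -/

/-- Membership in a monomial ideal is tested on each exponent w of `x`; if u ≤ v + w and u, v have
disjoint supports, then already u ≤ w. -/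
theorem MvPolynomial.mem_span_monomial_of_mul_mem {σ A : Type*} [CommRing A] {v : σ →₀ ℕ}
    {S : Set (σ →₀ ℕ)} (hS : ∀ u ∈ S, Disjoint u.support v.support) {x : MvPolynomial σ A}
    (hx : monomial v (1 : A) * x ∈ Ideal.span ((fun u => monomial u (1 : A)) '' S)) :
    x ∈ Ideal.span ((fun u => monomial u (1 : A)) '' S) := by
  rw [mem_ideal_span_monomial_image] at hx ⊢
  intro w hw
  obtain ⟨u, hu, huw⟩ := hx (v + w) (by
    rw [mem_support_iff, coeff_monomial_mul, one_mul]
    exact mem_support_iff.1 hw)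
  refine ⟨u, hu, fun i => ?_⟩
  by_cases hi : i ∈ u.support
  · have h1 := huw i
    have h2 : v i = 0 := Finsupp.notMem_support_iff.1 (Finset.disjoint_left.1 (hS u hu) hi)
    rwa [Finsupp.add_apply, h2, zero_add] at h1
  · rw [Finsupp.notMem_support_iff.1 hi]
    exact Nat.zero_le _

section Generic

variable {s r : ℕ} {n : Fin s → ℕ} {d : Fin r → Fin s → ℕ} {K : Type u} [CommRing K]

instance finite_sigmaIndex : Finite (Πₗ j : Fin s, Fin (n j + 1)) :=
  inferInstanceAs (Finite ((j : Fin s) → Fin (n j + 1)))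

variable (n) in
/-- The exponent of the monomial `X_{1,l} ⋯ X_{s,l}`. -/
noncomputable def diagonalExponent (l : ℕ) : ((j : Fin s) × Fin (n j + 1)) →₀ ℕ :=
  Finsupp.equivFunOnFinite.symm fun v => if v.2.1 = l then 1 else 0

theorem monomial_diagonalExponent {l : ℕ} (hl : ∀ j, l < n j + 1) :
    MvPolynomial.monomial (diagonalExponent n l) (1 : CoeffRing n d K) =
      sigmaMonomial n d K (toLex fun j => ⟨l, hl j⟩) := by
  rw [MvPolynomial.monomial_eq, map_one, one_mul,
    Finsupp.prod_fintype _ _ (fun _ => pow_zero _), Fintype.prod_sigma, sigmaMonomial]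
  refine Finset.prod_congr rfl fun j _ => ?_
  rw [Finset.prod_eq_single_of_mem (⟨l, hl j⟩ : Fin (n j + 1)) (Finset.mem_univ _)]
  · simp [diagonalExponent]
  · intro i _ hi
    have : i.1 ≠ l := fun h => hi (Fin.ext h)
    simp [diagonalExponent, this]

theorem disjoint_support_diagonalExponent {l l' : ℕ} (h : l ≠ l') :
    Disjoint (diagonalExponent n l).support (diagonalExponent n l').support := by
  rw [Finset.disjoint_left]
  intro v hv hv'
  simp only [diagonalExponent, Finsupp.mem_support_iff, Finsupp.equivFunOnFinite_symm_apply_apply,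
    ne_eq, ite_eq_right_iff, one_ne_zero, imp_false, not_not] at hv hv'
  exact h (hv.symm.trans hv')

/-- Descending induction on the number `k` of diagonal monomials divided out: nothing is claimed for
k = N, and removing each regular element from the ideal gains a degree. -/
theorem cechExact_quotient_diagonal {N : ℕ} (hN : ∀ j, N ≤ n j + 1) (m k : ℕ) (hk : k + m = N) :
    CechExact (sigmaMonomial n d K) (FormRing n d K ⧸
      Ideal.span ((fun u => MvPolynomial.monomial u (1 : CoeffRing n d K)) ''
        (diagonalExponent n '' {l | l < k}))) m := by
  induction m generalizing k with
  | zero => exact fun p hp => absurd hp (Nat.not_lt_zero p)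
  | succ m ih =>
    have hl : ∀ j, k < n j + 1 := fun j => lt_of_lt_of_le (by omega) (hN j)
    refine (ih (k + 1) (by omega)).of_quotient_sup (i := toLex fun j => ⟨k, hl j⟩) ?_ ?_
    · have h1 : {l | l < k + 1} = insert k {l | l < k} := by
        ext l
        simp only [Set.mem_ofPred_eq, Set.mem_insert_iff]
        omega
      rw [h1, Set.image_insert_eq, Set.image_insert_eq, Ideal.span_insert,
        monomial_diagonalExponent hl, sup_comm]
    · intro y hy
      rw [← monomial_diagonalExponent hl] at hy
      refine MvPolynomial.mem_span_monomial_of_mul_mem ?_ hy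
      rintro _ ⟨l, hl, rfl⟩
      exact disjoint_support_diagonalExponent (ne_of_lt hl)

theorem cechExact_formRing_quotient_bot {N : ℕ} (hN : ∀ j, N ≤ n j + 1) :
    CechExact (sigmaMonomial n d K) (FormRing n d K ⧸ (⊥ : Ideal (FormRing n d K))) N := by
  have h := cechExact_quotient_diagonal (d := d) (K := K) hN N 0 (zero_add N)
  have h1 : {l : ℕ | l < 0} = ∅ := by
    ext l
    simp
  rwa [h1, Set.image_empty, Set.image_empty, Ideal.span_empty] at h

/-! ### Elimination of a coefficient of each generic form -/

variable (n d K) in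
/-- The monomial `X₁^{α₁} ⋯ X_s^{α_s}`. -/
noncomputable def packetMonomial (α : (j : Fin s) → Fin (n j + 1) → ℕ) : FormRing n d K :=
  ∏ j : Fin s, ∏ l : Fin (n j + 1), MvPolynomial.X ⟨j, l⟩ ^ α j l

/-- The exponents of the monomial of multidegree `e` in the variables `X_{1,t₁}, …, X_{s,t_s}`. -/
def pureExponent (t : (j : Fin s) → Fin (n j + 1)) (e : Fin s → ℕ) :
    {α // α ∈ multiExponents n e} :=
  ⟨fun j l => if l = t j then e j else 0, by simp [mem_multiExponents]⟩

theorem packetMonomial_pureExponent (t : (j : Fin s) → Fin (n j + 1)) (e : Fin s → ℕ) :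
    packetMonomial n d K (pureExponent t e).1 = ∏ j, MvPolynomial.X ⟨j, t j⟩ ^ e j := by
  refine Finset.prod_congr rfl fun j _ => ?_
  rw [Finset.prod_eq_single_of_mem (t j) (Finset.mem_univ _)]
  · simp [pureExponent]
  · intro i _ hi
    simp [pureExponent, hi]

/-- Makes the coefficient to be eliminated a coefficient of a unit once σ_t is inverted. The
exponent is only a crude common bound for all the `e j`. -/
theorem packetMonomial_pureExponent_dvd (t : Πₗ j : Fin s, Fin (n j + 1)) (e : Fin s → ℕ) :
    packetMonomial n d K (pureExponent (ofLex t) e).1 ∣ sigmaMonomial n d K t ^ ∑ j, e j := by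
  rw [packetMonomial_pureExponent, sigmaMonomial, ← Finset.prod_pow]
  exact Finset.prod_dvd_prod_of_dvd _ _ fun j _ =>
    pow_dvd_pow _ (Finset.single_le_sum (fun _ _ => Nat.zero_le _) (Finset.mem_univ j))

variable (d K) in
/-- The part of `f_i` not involving the coefficient of the monomial in the variables
`X_{1,t₁}, …, X_{s,t_s}`. -/
noncomputable def genericFormTail (t : (j : Fin s) → Fin (n j + 1)) (i : Fin r) :
    FormRing n d K :=
  ∑ α ∈ Finset.univ.erase (pureExponent t (d i)),
    MvPolynomial.C (MvPolynomial.X ⟨i, α⟩) * packetMonomial n d K α.1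

theorem genericForm_eq_add_tail (t : (j : Fin s) → Fin (n j + 1)) (i : Fin r) :
    genericForm n d K i =
      MvPolynomial.C (MvPolynomial.X ⟨i, pureExponent t (d i)⟩) *
        packetMonomial n d K (pureExponent t (d i)).1 + genericFormTail d K t i :=
  (Finset.add_sum_erase _ _ (Finset.mem_univ _)).symm

theorem genericForm_ne_zero [Nontrivial K] (i : Fin r) : genericForm n d K i ≠ 0 := by
  classical
  intro h
  let c : CoeffIndex n d := ⟨i, pureExponent (fun _ => 0) (d i)⟩
  -- Specialize all variables and one coefficient of f_i to 1, all other coefficients to 0.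
  let ψ : FormRing n d K →+* K :=
    MvPolynomial.eval₂Hom (MvPolynomial.eval fun c' => if c' = c then 1 else 0) fun _ => 1
  have h1 : ψ (genericForm n d K i) = 1 := by
    rw [genericForm, map_sum, Finset.sum_eq_single_of_mem c.2 (Finset.mem_univ _)]
    · simp [ψ, c]
    · intro α _ hα
      have : (⟨i, α⟩ : CoeffIndex n d) ≠ c := fun e => hα (eq_of_heq (Sigma.mk.inj e).2)
      simp [ψ, this]
  rw [h, map_zero] at h1
  exact zero_ne_one h1

/-! ### The substitution homomorphism and its kernel -/

section Elimination

variable [IsDomain K]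

open Classical in
variable (n d K) in
/-- The substitution solving `f_l = 0` for the coefficient of the monomial in
`X_{1,t₁}, …, X_{s,t_s}`, for all `l < k`. -/
noncomputable def eliminationValue (t : (j : Fin s) → Fin (n j + 1)) (k : Fin r)
    (c : CoeffIndex n d) : FractionRing (FormRing n d K) :=
  if c.1 < k ∧ c.2 = pureExponent t (d c.1) then
    -algebraMap (FormRing n d K) _ (genericFormTail d K t c.1) /
      algebraMap (FormRing n d K) _ (packetMonomial n d K (pureExponent t (d c.1)).1)
  else algebraMap (FormRing n d K) _ (MvPolynomial.C (MvPolynomial.X c))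

variable (n d K) in
/-- The ring homomorphism given by the substitution `eliminationValue`. -/
noncomputable def eliminationHom (t : (j : Fin s) → Fin (n j + 1)) (k : Fin r) :
    FormRing n d K →+* FractionRing (FormRing n d K) :=
  MvPolynomial.eval₂Hom
    (MvPolynomial.eval₂Hom ((algebraMap (FormRing n d K) _).comp
      (MvPolynomial.C.comp MvPolynomial.C)) (eliminationValue n d K t k))
    fun v => algebraMap (FormRing n d K) _ (MvPolynomial.X v)

variable (t : (j : Fin s) → Fin (n j + 1)) (k : Fin r)

theorem eliminationHom_X (v : (j : Fin s) × Fin (n j + 1)) :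
    eliminationHom n d K t k (MvPolynomial.X v) = algebraMap (FormRing n d K) _ (MvPolynomial.X v) := by
  simp [eliminationHom]

theorem eliminationHom_C_X (c : CoeffIndex n d) :
    eliminationHom n d K t k (MvPolynomial.C (MvPolynomial.X c)) = eliminationValue n d K t k c := by
  simp [eliminationHom]

theorem eliminationHom_C_C (κ : K) :
    eliminationHom n d K t k (MvPolynomial.C (MvPolynomial.C κ)) =
      algebraMap (FormRing n d K) _ (MvPolynomial.C (MvPolynomial.C κ)) := by
  simp [eliminationHom]

theorem eliminationHom_packetMonomial (α : (j : Fin s) → Fin (n j + 1) → ℕ) :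
    eliminationHom n d K t k (packetMonomial n d K α) =
      algebraMap _ _ (packetMonomial n d K α) := by
  simp only [packetMonomial, map_prod, map_pow, eliminationHom_X]

theorem eliminationHom_genericFormTail (i : Fin r) :
    eliminationHom n d K t k (genericFormTail d K t i) =
      algebraMap _ _ (genericFormTail d K t i) := by
  rw [genericFormTail, map_sum, map_sum]
  refine Finset.sum_congr rfl fun α hα => ?_
  rw [map_mul, map_mul, eliminationHom_packetMonomial, eliminationHom_C_X, eliminationValue,
    if_neg (fun h => (Finset.mem_erase.1 hα).1 h.2)]

theorem packetMonomial_pureExponent_ne_zero (e : Fin s → ℕ) :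
    packetMonomial n d K (pureExponent t e).1 ≠ 0 := by
  rw [packetMonomial_pureExponent]
  exact Finset.prod_ne_zero_iff.2 fun j _ => pow_ne_zero _ (MvPolynomial.X_ne_zero _)

theorem algebraMap_packetMonomial_ne_zero (e : Fin s → ℕ) :
    algebraMap (FormRing n d K) (FractionRing (FormRing n d K))
      (packetMonomial n d K (pureExponent t e).1) ≠ 0 :=
  (map_ne_zero_iff _ (IsFractionRing.injective _ _)).2 (packetMonomial_pureExponent_ne_zero t e)

theorem eliminationHom_genericForm_of_lt {l : Fin r} (hl : l < k) :
    eliminationHom n d K t k (genericForm n d K l) = 0 := by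
  rw [genericForm_eq_add_tail t, map_add, map_mul, eliminationHom_packetMonomial,
    eliminationHom_C_X, eliminationHom_genericFormTail, eliminationValue, if_pos ⟨hl, rfl⟩,
    div_mul_cancel₀ _ (algebraMap_packetMonomial_ne_zero t _), neg_add_cancel]

theorem eliminationHom_genericForm_self :
    eliminationHom n d K t k (genericForm n d K k) = algebraMap _ _ (genericForm n d K k) := by
  rw [genericForm_eq_add_tail t, map_add, map_add, map_mul, map_mul,
    eliminationHom_packetMonomial, eliminationHom_C_X, eliminationHom_genericFormTail,
    eliminationValue, if_neg (fun h => lt_irrefl _ h.1)]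

/-- Up to a power of σ_t, the substitution changes nothing modulo (f_l, l < k): a single `y`
represents both σ_t^N x modulo this ideal and its image. Hence an `x` in the kernel has σ_t^N x in
the ideal. The property is stable under sums and products, so it need only be checked on generators.
-/
theorem exists_eliminationHom_eq (t : Πₗ j : Fin s, Fin (n j + 1)) (x : FormRing n d K) :
    ∃ (N : ℕ) (y : FormRing n d K),
      sigmaMonomial n d K t ^ N * x - y ∈ Ideal.span (genericForm n d K '' {l | l < k}) ∧
      algebraMap _ _ (sigmaMonomial n d K t ^ N) * eliminationHom n d K (ofLex t) k x =
        algebraMap _ _ y := by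
  let P : FormRing n d K → Prop := fun x => ∃ (N : ℕ) (y : FormRing n d K),
    sigmaMonomial n d K t ^ N * x - y ∈ Ideal.span (genericForm n d K '' {l | l < k}) ∧
    algebraMap _ _ (sigmaMonomial n d K t ^ N) * eliminationHom n d K (ofLex t) k x =
      algebraMap _ _ y
  have hadd : ∀ x x', P x → P x' → P (x + x') := by
    rintro x x' ⟨N, y, h, e⟩ ⟨N', y', h', e'⟩
    refine ⟨N + N', sigmaMonomial n d K t ^ N' * y + sigmaMonomial n d K t ^ N * y', ?_, ?_⟩
    · have h1 := add_mem (Ideal.mul_mem_left _ (sigmaMonomial n d K t ^ N') h)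
        (Ideal.mul_mem_left _ (sigmaMonomial n d K t ^ N) h')
      convert h1 using 1
      ring
    · simp only [map_add, map_mul, ← e, ← e', pow_add]
      ring
  have hmul : ∀ x x', P x → P x' → P (x * x') := by
    rintro x x' ⟨N, y, h, e⟩ ⟨N', y', h', e'⟩
    refine ⟨N + N', y * y', ?_, ?_⟩
    · have h1 := add_mem (Ideal.mul_mem_left _ (sigmaMonomial n d K t ^ N' * x') h)
        (Ideal.mul_mem_left _ y h')
      convert h1 using 1
      ring
    · simp only [map_mul, ← e, ← e', pow_add]
      ring
  change P x
  induction x using MvPolynomial.induction_on with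
  | C b =>
    induction b using MvPolynomial.induction_on with
    | C κ => exact ⟨0, MvPolynomial.C (MvPolynomial.C κ), by simp, by simp [eliminationHom_C_C]⟩
    | add p q hp hq =>
      rw [map_add]
      exact hadd _ _ hp hq
    | mul_X p c hp =>
      rw [map_mul]
      refine hmul _ _ hp ?_
      by_cases hc : c.1 < k ∧ c.2 = pureExponent (ofLex t) (d c.1)
      · obtain ⟨i, α⟩ := c
        obtain ⟨hi, hα⟩ : i < k ∧ α = pureExponent (ofLex t) (d i) := hc
        subst hα
        obtain ⟨q, hq⟩ := packetMonomial_pureExponent_dvd (d := d) (K := K) t (d i)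
        -- The only generator that moves. With σ_t^(∑ d) = (pure monomial) · q, the relation f_i ≡ 0
        -- reads (pure monomial) · U ≡ -tail; multiply it by q.
        refine ⟨∑ j, d i j, -(q * genericFormTail d K (ofLex t) i), ?_, ?_⟩
        · have h1 := Ideal.mul_mem_left (Ideal.span (genericForm n d K '' {l | l < k})) q
            (Ideal.subset_span ⟨i, hi, rfl⟩)
          rw [genericForm_eq_add_tail (ofLex t)] at h1
          rw [hq]
          convert h1 using 1
          ring
        · rw [eliminationHom_C_X, eliminationValue, if_pos ⟨hi, rfl⟩, hq]
          have h1 := algebraMap_packetMonomial_ne_zero (d := d) (K := K) (ofLex t) (d i)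
          simp only [map_mul, map_neg]
          field_simp
      · refine ⟨0, MvPolynomial.C (MvPolynomial.X c), by simp, ?_⟩
        rw [eliminationHom_C_X, eliminationValue, if_neg hc]
        simp
  | add p q hp hq => exact hadd _ _ hp hq
  | mul_X p v hp =>
    exact hmul _ _ hp ⟨0, MvPolynomial.X v, by simp, by simp [eliminationHom_X]⟩

/-- The generic form `f_k` is regular modulo `(f_l, l < k)` after inverting `σ_t`. -/
theorem exists_sigmaMonomial_pow_mul_mem (t : Πₗ j : Fin s, Fin (n j + 1)) {x : FormRing n d K}
    (hx : genericForm n d K k * x ∈ Ideal.span (genericForm n d K '' {l | l < k})) :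
    ∃ N : ℕ, sigmaMonomial n d K t ^ N * x ∈ Ideal.span (genericForm n d K '' {l | l < k}) := by
  have hle : Ideal.span (genericForm n d K '' {l | l < k}) ≤
      RingHom.ker (eliminationHom n d K (ofLex t) k) := by
    rw [Ideal.span_le]
    rintro _ ⟨l, hl, rfl⟩
    exact eliminationHom_genericForm_of_lt (ofLex t) k hl
  have h1 : eliminationHom n d K (ofLex t) k x = 0 := by
    have h2 := (RingHom.mem_ker).1 (hle hx)
    rw [map_mul, eliminationHom_genericForm_self] at h2
    refine (mul_eq_zero.1 h2).resolve_left ?_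
    exact (map_ne_zero_iff _ (IsFractionRing.injective _ _)).2 (genericForm_ne_zero k)
  obtain ⟨N, y, hy, hxy⟩ := exists_eliminationHom_eq k t x
  rw [h1, mul_zero] at hxy
  have h3 : y = 0 := (map_eq_zero_iff _ (IsFractionRing.injective _ _)).1 hxy.symm
  rw [h3, sub_zero] at hy
  exact ⟨N, hy⟩

end Elimination

/-! ### The generic forms are a weakly regular sequence -/

/-- Exactness and regularity are obtained alternately: exactness in degree 0 for the first `k` forms
makes the next form regular, and regularity then gives exactness for `k + 1` forms in one degree
less. -/
theorem cechExact_quotient_genericForm [IsDomain K] {N : ℕ} (hN : ∀ j, N ≤ n j + 1) (k : ℕ)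
    (hk : k ≤ r) (m : ℕ) (hm : k + m = N) :
    CechExact (sigmaMonomial n d K)
      (FormRing n d K ⧸ Ideal.span (genericForm n d K '' {l | l.1 < k})) m := by
  induction k generalizing m with
  | zero =>
    have h1 : {l : Fin r | l.1 < 0} = ∅ := by
      ext l
      simp
    rw [h1, Set.image_empty, Ideal.span_empty]
    obtain rfl : m = N := by omega
    exact cechExact_formRing_quotient_bot hN
  | succ k ih =>
    have ih' := ih (by omega) (m + 1) (by omega)
    refine ih'.quotient_sup (x := genericForm n d K ⟨k, hk⟩) ?_ ?_
    · have h1 : {l : Fin r | l.1 < k + 1} = insert ⟨k, hk⟩ {l : Fin r | l.1 < k} := by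
        ext l
        simp only [Set.mem_ofPred_eq, Set.mem_insert_iff, Fin.ext_iff]
        omega
      rw [h1, Set.image_insert_eq, Ideal.span_insert, sup_comm]
    · exact fun y hy => ih'.mem_ideal (Nat.succ_pos m) fun t =>
        exists_sigmaMonomial_pow_mul_mem ⟨k, hk⟩ t hy

end Generic

theorem mainTheorem5 {K : Type u} [CommRing K] [IsDomain K]
    (s : ℕ) (hs : 0 < s) (n : Fin s → ℕ) (hn : Monotone n) (hn1 : 1 ≤ n ⟨0, hs⟩)
    (r : ℕ) (d : Fin r → Fin s → ℕ) (hd : ∀ i j, d i j ≠ 0)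
    (hr : r ≤ n ⟨0, hs⟩ + 1) :
    (∀ p : ℕ, p ≠ 0 →
      CategoryTheory.Limits.IsZero ((koszulComplex (genericForm n d K)).homology p)) ∧
    (r < n ⟨0, hs⟩ + 1 → ∀ i : ℕ, i + r < n ⟨0, hs⟩ + 1 →
      CategoryTheory.Limits.IsZero (localCohomologyB n d K i)) := by
  have hN : ∀ j, n ⟨0, hs⟩ + 1 ≤ n j + 1 := fun j =>
    Nat.succ_le_succ (hn (Fin.mk_le_of_le_val (Nat.zero_le _)))
  refine ⟨fun p hp => isZero_homology_koszulComplex _ (fun k x hx => ?_) hp, fun _ i hi => ?_⟩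
  -- As k < r ≤ n₁ + 1, at least one degree of exactness is left, which is what the passage from
  -- local to global regularity needs. This is why r = n₁ + 1 is still allowed here.
  · have h := cechExact_quotient_genericForm (d := d) (K := K) hN k.1 k.2.le
      (n ⟨0, hs⟩ + 1 - k.1) (by omega)
    exact h.mem_ideal (by omega) fun t => exists_sigmaMonomial_pow_mul_mem k t hx
  · have h := cechExact_quotient_genericForm (d := d) (K := K) hN r le_rfl
      (n ⟨0, hs⟩ + 1 - r) (by omega)
    have h1 : {l : Fin r | l.1 < r} = Set.univ := by
      ext l
      simp
    rw [h1, Set.image_univ] at h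
    exact h.isZero_homology (by omega)
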